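/- Let ${\cal G}$ be a closed graph: the geometric realization of a finite undirected graph $(V,E)$ without boundary (self-loops and multiple edges allowed), each edge $e$ being an interval of length $\ell_e>0$, equipped with a vertex measure ${\cal V}$ (a finite measure supported on $V$ with ${\cal V}(\{v\})>0$ for every $v\in V$) and an edge measure ${\cal E}$ (zero on vertices, and equal to a constant $a_e>0$ times Lebesgue measure on the interior of each edge $e$). Let $C^1({\cal G})$ be the set of continuous $f\colon{\cal G}\to\mathbb{R}$ that are differentiable with uniformly continuous derivative on each edge interior; $\|f\|_p$ is the $L^p$ norm with respect to ${\cal V}$ and $\|\nabla f\|_1=\int|\nabla f|\,d{\cal E}$. Call $f$ split if ${\cal V}(\{f>0\})$ and ${\cal V}(\{f<0\})$ are both at most ${\cal V}({\cal G})/2$. Call $\Omega\subset{\cal G}$ admissible if it is open and its boundary $\partial\Omega$ is finite. Write $|\Omega|={\cal V}(\Omega)$, let $\Omega^c$ be the complement of $\Omega$, and let $$|\partial\Omega|=\sum_{x\in\partial\Omega\setminus V}a_{e(x)}+\sum_{v\in\partial\Omega\cap V}\ \sum_{e:\ v\in\overline{\Omega\cap \mathrm{int}(e)}}a_e ,$$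 where $e(x)$ is the edge containing $x$ and $\mathrm{int}(e)$ is the interior of $e$. For $1\le\nu\le\infty$ let $\nu'$ be the dual exponent, $1/\nu+1/\nu'=1$, and set $$\widetilde I_\nu=\inf_{\Omega}|\partial\Omega|\min(|\Omega|,|\Omega^c|)^{(1/\nu)-1},\qquad \widetilde I'_\nu=\inf_{\Omega}|\partial\Omega|\bigl(|\Omega|^{1-\nu}+|\Omega^c|^{1-\nu}\bigr)^{1/\nu},$$ the infima being over admissible $\Omega$ with $|\Omega|,|\Omega^c|>0$, where for $\nu=\infty$ the last factor is replaced by its limit $\max(|\Omega|^{-1},|\Omega^c|^{-1})$; and $$\widetilde S_\nu=\inf_{f\in C^1({\cal G})}\frac{\|\nabla f\|_1}{\min_{a\in\mathbb{R}}\|f-a\|_{\nu'}},\qquad \widetilde S_{',\nu}=\inf_{f\in C^1({\cal G}),\ f\ \mathrm{split}}\frac{\|\nabla f\|_1}{\|f\|_{\nu'}},$$ the infima being over those $f$ for which the denominator is nonzero. An infimum over the empty set is $+\infty$, and $\infty\cdot 0=0$. Then for every $1\le\nu\le\infty$: $$\widetilde I'_\nu=\widetilde S_\nu,\qquad \widetilde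 I_\nu=\widetilde S_{',\nu},\qquad \widetilde I_\nu\le\widetilde I'_\nu\le 2^{1/\nu}\,\widetilde I_\nu .$$ In particular, for every split $f\in C^1({\cal G})$, $\|\nabla f\|_1\ge\widetilde I_\nu\,\|f\|_{\nu'}$. -/

import Mathlib

open Set MeasureTheory
open scoped ENNReal NNReal

noncomputable section

/-- A closed graph: an undirected graph with finite vertex set `V`, finite edge set `E` and no
boundary; self-loops, multiple edges and isolated vertices are allowed. Each edge `e` has a
length `ℓ_e > 0` and an edge-measure density `a_e > 0`; each vertex `v` has a mass `𝒱(v) > 0`.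
The names `src e`, `tgt e` of the endpoints of `e` only fix a parametrisation of the edge. -/
structure ClosedGraph (V E : Type*) [Fintype V] [Fintype E] where
  src : E → V
  tgt : E → V
  len : E → ℝ
  len_pos : ∀ e, 0 < len e
  weight : E → ℝ≥0
  weight_pos : ∀ e, 0 < weight e
  mass : V → ℝ≥0
  mass_pos : ∀ v, 0 < mass v

namespace ClosedGraph

variable {V E : Type*} [Fintype V] [Fintype E] (G : ClosedGraph V E)

/-- The disjoint union of the vertex set and of one interval `[0, ℓ_e]` for each edge `e`. -/
def Pieces : Type _ := V ⊕ (Σ e : E, Icc (0 : ℝ) (G.len e))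

/-- Disjoint-union topology, the vertex set being discrete. -/
instance : TopologicalSpace G.Pieces :=
  letI : TopologicalSpace V := ⊥
  inferInstanceAs (TopologicalSpace (V ⊕ (Σ e : E, Icc (0 : ℝ) (G.len e))))

/-- The two ends of each interval are glued to the endpoints of the edge. -/
inductive Glue : G.Pieces → G.Pieces → Prop
  | src (e : E) : Glue (Sum.inr ⟨e, 0, left_mem_Icc.2 (G.len_pos e).le⟩) (Sum.inl (G.src e))
  | tgt (e : E) : Glue (Sum.inr ⟨e, G.len e, right_mem_Icc.2 (G.len_pos e).le⟩)
      (Sum.inl (G.tgt e))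

/-- The geometric realization `𝒢`, with the quotient topology (for a finite graph this is the
topology of the path metric) and its Borel σ-algebra. -/
def Realization : Type _ := Quot G.Glue

instance : TopologicalSpace G.Realization := inferInstanceAs (TopologicalSpace (Quot G.Glue))

instance : MeasurableSpace G.Realization := borel _

instance : BorelSpace G.Realization := ⟨rfl⟩

/-- A vertex as a point of `𝒢`. -/
def vertex (v : V) : G.Realization := Quot.mk _ (Sum.inl v)

/-- The closed edge `e`, parametrised by arc length. -/
def edgeMap (e : E) (s : Icc (0 : ℝ) (G.len e)) : G.Realization := Quot.mk _ (Sum.inr ⟨e, s⟩)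

/-- The disjoint union of the edge interiors, that is `𝒢 ∖ V`. -/
abbrev EdgeInteriors : Type _ := Σ e : E, Ioo (0 : ℝ) (G.len e)

/-- The inclusion of `𝒢 ∖ V` into `𝒢`. -/
def interiorPoint (x : G.EdgeInteriors) : G.Realization :=
  G.edgeMap x.1 ⟨x.2, Ioo_subset_Icc_self x.2.2⟩

/-- The interior of the edge `e`, as a subset of `𝒢`. -/
def edgeInterior (e : E) : Set G.Realization :=
  range fun s : Ioo (0 : ℝ) (G.len e) => G.interiorPoint ⟨e, s⟩

/-- The vertex measure `𝒱` on `𝒢`. -/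
def vertexMeasure : Measure G.Realization :=
  ∑ v, (G.mass v : ℝ≥0∞) • Measure.dirac (G.vertex v)

/-- The edge measure `ℰ`: it vanishes on vertices, so it is a measure on `𝒢 ∖ V`, and on the
interior of `e` it is `a_e` times Lebesgue measure. -/
def edgeMeasure : Measure G.EdgeInteriors :=
  ∑ e, (G.weight e : ℝ≥0∞) •
    Measure.map (Sigma.mk e) (Measure.comap (Subtype.val : Ioo (0 : ℝ) (G.len e) → ℝ) volume)

/-- `f` along the edge `e` as a function of arc length (extended constantly outside
`[0, ℓ_e]`). -/
def alongEdge (f : G.Realization → ℝ) (e : E) : ℝ → ℝ :=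
  IccExtend (G.len_pos e).le fun s => f (G.edgeMap e s)

/-- `f ∈ C¹(𝒢)`: `f` is continuous and on each edge interior it is differentiable with
uniformly continuous derivative. No matching of derivatives at vertices is required. On a closed
graph every such function is of finite type and satisfies the Dirichlet condition. -/
def IsC1 (f : G.Realization → ℝ) : Prop :=
  Continuous f ∧ ∀ e, DifferentiableOn ℝ (G.alongEdge f e) (Ioo 0 (G.len e)) ∧
    UniformContinuousOn (deriv (G.alongEdge f e)) (Ioo 0 (G.len e))

/-- The gradient `∇f`, a vector field on the edge interiors, written as a real function by means
of the orientation of each edge from `src` to `tgt`. -/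
def grad (f : G.Realization → ℝ) (x : G.EdgeInteriors) : ℝ :=
  deriv (G.alongEdge f x.1) x.2

/-- `‖∇f‖₁`, taken with respect to `ℰ`. -/
def gradNorm (f : G.Realization → ℝ) : ℝ≥0∞ := eLpNorm (G.grad f) 1 G.edgeMeasure

/-- `f` is split: it is positive, respectively negative, on at most half of the vertex measure. -/
def IsSplit (f : G.Realization → ℝ) : Prop :=
  G.vertexMeasure {x | 0 < f x} ≤ G.vertexMeasure univ / 2 ∧
    G.vertexMeasure {x | f x < 0} ≤ G.vertexMeasure univ / 2

/-- The area `|∂Ω|` of the topological boundary of an open set `Ω`: each boundary point in the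
interior of an edge `e` contributes `a_e`, and each boundary point that is a vertex `v`
contributes `a_e` for each edge `e` such that `v` is in the closure of `Ω` intersected with the
interior of `e`. -/
def area (Ω : Set G.Realization) : ℝ≥0∞ :=
  (∑' x : {x : G.EdgeInteriors // G.interiorPoint x ∈ frontier Ω}, (G.weight x.1.1 : ℝ≥0∞)) +
    ∑' v : {v : V // G.vertex v ∈ frontier Ω},
      ∑' e : {e : E // G.vertex v ∈ closure (Ω ∩ G.edgeInterior e)}, (G.weight e : ℝ≥0∞)

/-- Admissible sets: open with finite boundary. (There are no boundary vertices to avoid.) -/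
def Admissible (Ω : Set G.Realization) : Prop := IsOpen Ω ∧ (frontier Ω).Finite

open Classical in
/-- `|∂Ω| min(|Ω|, |Ωᶜ|)^{(1/ν) - 1}`, taken to be `+∞` if `|Ω| = 0` or `|Ωᶜ| = 0`. -/
def isoRatio (ν : ℝ≥0∞) (Ω : Set G.Realization) : ℝ≥0∞ :=
  if G.vertexMeasure Ω = 0 ∨ G.vertexMeasure Ωᶜ = 0 then ⊤ else
    G.area Ω * min (G.vertexMeasure Ω) (G.vertexMeasure Ωᶜ) ^ ((ν⁻¹).toReal - 1)

open Classical in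
/-- `|∂Ω| (|Ω|^{1-ν} + |Ωᶜ|^{1-ν})^{1/ν}`, taken to be `+∞` if `|Ω| = 0` or `|Ωᶜ| = 0`. For
`ν = ∞` the second factor is its limit `max(|Ω|⁻¹, |Ωᶜ|⁻¹)`. -/
def isoRatio' (ν : ℝ≥0∞) (Ω : Set G.Realization) : ℝ≥0∞ :=
  if G.vertexMeasure Ω = 0 ∨ G.vertexMeasure Ωᶜ = 0 then ⊤ else
    if ν = ⊤ then G.area Ω * max (G.vertexMeasure Ω)⁻¹ (G.vertexMeasure Ωᶜ)⁻¹ else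
      G.area Ω * (G.vertexMeasure Ω ^ (1 - ν.toReal) +
        G.vertexMeasure Ωᶜ ^ (1 - ν.toReal)) ^ (1 / ν.toReal)

/-- The isoperimetric constant `Ĩ_ν`. -/
def isoConst (ν : ℝ≥0∞) : ℝ≥0∞ := ⨅ (Ω) (_ : G.Admissible Ω), G.isoRatio ν Ω

/-- The isoperimetric constant `Ĩ'_ν`. -/
def isoConst' (ν : ℝ≥0∞) : ℝ≥0∞ := ⨅ (Ω) (_ : G.Admissible Ω), G.isoRatio' ν Ω

/-- `‖f‖_p`, taken with respect to `𝒱`. -/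
def norm (p : ℝ≥0∞) (f : G.Realization → ℝ) : ℝ≥0∞ := eLpNorm f p G.vertexMeasure

/-- `min_{a ∈ ℝ} ‖f - a‖_p`. -/
def normModConst (p : ℝ≥0∞) (f : G.Realization → ℝ) : ℝ≥0∞ := ⨅ a : ℝ, G.norm p fun x => f x - a

/-- The Sobolev constant modulo constants, `S̃_ν = inf_f ‖∇f‖₁ / min_a ‖f - a‖_{ν'}` over
`f ∈ C¹(𝒢)` for which the denominator is not zero. -/
def sobolevConst (ν : ℝ≥0∞) : ℝ≥0∞ :=
  ⨅ (f) (_ : G.IsC1 f) (_ : G.normModConst ν.conjExponent f ≠ 0),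
    G.gradNorm f / G.normModConst ν.conjExponent f

/-- The Sobolev constant of split functions, `inf_f ‖∇f‖₁ / ‖f‖_{ν'}` over split `f ∈ C¹(𝒢)` for
which the denominator is not zero. -/
def splitSobolevConst (ν : ℝ≥0∞) : ℝ≥0∞ :=
  ⨅ (f) (_ : G.IsC1 f) (_ : G.IsSplit f) (_ : G.norm ν.conjExponent f ≠ 0),
    G.gradNorm f / G.norm ν.conjExponent f

end ClosedGraph

end

/-! ### Weighted variation on the vertex set and the layer-cake inequality. -/

noncomputable section

namespace ClosedGraph

variable {V E : Type*} [Fintype V] [Fintype E] (G : ClosedGraph V E)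

/-! Everything reduces to the finite set `V`. The vertex measure sees only vertex values, and a `C¹`
function with vertex values `g` has gradient norm at least `variation g` (`variation_le_gradNorm`),
with equality for the affine interpolation (`gradNorm_interp`). Likewise an open set has area at
least the variation of the indicator of its vertices (`variation_le_area`), and every `A ⊆ V` is cut
out by an admissible set achieving this bound (`exists_admissible`). So the isoperimetric constants
are infima over proper nonempty `A ⊆ V`, and the Sobolev inequalities concern functions on `V`.

On `V` the argument is of Federer–Fleming type. A function `g ≥ 0` is a positive combination of
indicators of its nested superlevel sets; variation is additive along this decomposition and a
seminorm is subadditive, so an inequality for indicators passes to `g`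
(`mul_le_variation_of_nonneg`). Modulo constants, `g` is first made nonnegative by a shift; a split
`g` is handled through its positive and negative parts, whose superlevel sets have at most half the
mass.

Indicators give the converse inequalities, since their norms are exactly the reciprocals of the
isoperimetric factors. Modulo constants this is the two-point Hölder inequality with its equality
case (`modNorm_indicator`). Comparing the factors of the two isoperimetric constants gives the
bounds between them. -/

/-- The total variation of a function on the vertices, weighted by the edge densities. -/
def variation (g : V → ℝ) : ℝ≥0∞ :=
  ∑ e, (G.weight e : ℝ≥0∞) * ‖g (G.tgt e) - g (G.src e)‖ₑ

/-- Variation is only subadditive in general; this isolates the absence of cancellation that makes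
it additive, for layers and for positive and negative parts. -/
theorem variation_eq_of_abs {g h k : V → ℝ} {c : ℝ} (hc : 0 ≤ c)
    (H : ∀ x y, |g x - g y| = c * |h x - h y| + |k x - k y|) :
    G.variation g = ‖c‖ₑ * G.variation h + G.variation k := by
  simp only [variation, Finset.mul_sum, ← Finset.sum_add_distrib]
  refine Finset.sum_congr rfl fun e _ => ?_
  rw [Real.enorm_eq_ofReal_abs (g _ - g _), H, ENNReal.ofReal_add (by positivity) (by positivity),
    ENNReal.ofReal_mul hc, ← Real.enorm_eq_ofReal_abs, ← Real.enorm_eq_ofReal_abs,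
    ← Real.enorm_eq_ofReal hc]
  ring

theorem variation_indicator_compl (A : Set V) :
    G.variation (Aᶜ.indicator 1) = G.variation (A.indicator 1) := by
  have h : (Aᶜ.indicator 1 : V → ℝ) = fun v => 1 - A.indicator 1 v := by
    ext v; by_cases hv : v ∈ A <;> simp [hv]
  simp only [variation, h]
  refine Finset.sum_congr rfl fun e _ => ?_
  rw [← enorm_neg]; congr 2; ring

theorem variation_sub_const (g : V → ℝ) (a : ℝ) :
    G.variation (fun v => g v - a) = G.variation g := by
  simp [variation]

theorem variation_eq_pos_add_neg (g : V → ℝ) :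
    G.variation g = G.variation (fun v => max (g v) 0) + G.variation (fun v => max (-g v) 0) := by
  have := G.variation_eq_of_abs (g := g) (h := fun v => max (g v) 0)
    (k := fun v => max (-g v) 0) zero_le_one fun x y => by
      rcases le_total (g x) 0 with hx | hx <;> rcases le_total (g y) 0 with hy | hy <;>
        simp only [hx, hy, max_eq_left, max_eq_right, neg_nonneg, neg_nonpos, one_mul, sub_self,
          abs_zero] <;> grind
  simpa using this

/-- Layer-cake principle: an isoperimetric inequality for the superlevel sets of `g ≥ 0` gives
the corresponding Sobolev inequality for `g`. -/
theorem mul_le_variation_of_nonneg {N : (V → ℝ) → ℝ≥0∞}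
    (hadd : ∀ f g, N (f + g) ≤ N f + N g)
    (hsmul : ∀ (c : ℝ) f, 0 ≤ c → N (c • f) ≤ ‖c‖ₑ * N f) (K : ℝ≥0∞) {g : V → ℝ} (hg : 0 ≤ g)
    (h : ∀ A ⊆ {v | 0 < g v}, K * N (A.indicator 1) ≤ G.variation (A.indicator 1)) :
    K * N g ≤ G.variation g := by
  -- Induct on the size of the support, removing the bottom layer `c • 1_S` of height the least
  -- positive value `c`; the minimiser then leaves the support.
  induction hn : {v | 0 < g v}.ncard using Nat.strong_induction_on generalizing g with
  | _ n ih =>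
  set S := {v | 0 < g v} with hS
  rcases S.eq_empty_or_nonempty with hE | hne
  · have : g = (0 : ℝ) • 0 := by
      ext v
      have : v ∉ S := by simp [hE]
      simpa using le_antisymm (not_lt.1 this) (hg v)
    have h0 : N g = 0 := by
      rw [this]; simpa using hsmul 0 0 le_rfl
    simp [h0]
  obtain ⟨v₀, hv₀, hmin⟩ := Set.exists_min_image S g S.toFinite hne
  set c := g v₀ with hc
  have hc0 : 0 < c := hv₀
  set g' : V → ℝ := fun v => g v - c * S.indicator 1 v with hg'
  have hin : ∀ v ∈ S, g' v = g v - c := fun v hv => by simp [hg', hv]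
  have hout : ∀ v ∉ S, g v = 0 := fun v hv => le_antisymm (not_lt.1 hv) (hg v)
  have hout' : ∀ v ∉ S, g' v = 0 := fun v hv => by simp [hg', hv, hout v hv]
  have hg'0 : 0 ≤ g' := fun v => by
    by_cases hv : v ∈ S
    · simpa [hin v hv] using hmin v hv
    · simp [hout' v hv]
  have hsub : {v | 0 < g' v} ⊆ S := fun v hv => by
    by_contra hvS
    simp [hout' v hvS] at hv
  have hlt : {v | 0 < g' v}.ncard < n := by
    rw [← hn]
    refine Set.ncard_lt_ncard ⟨hsub, fun hle => ?_⟩ S.toFinite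
    have := hle hv₀
    simp [hin v₀ hv₀, hc] at this
  -- No cancellation: within `S` the layer is constant, outside `S` both summands vanish, and across
  -- the boundary of `S` both jumps point into `S`.
  have hvar : G.variation g = ‖c‖ₑ * G.variation (S.indicator 1) + G.variation g' := by
    refine G.variation_eq_of_abs hc0.le fun x y => ?_
    by_cases hx : x ∈ S <;> by_cases hy : y ∈ S
    · simp [hx, hy, hin]
    · have := hg'0 x
      rw [hin x hx] at this
      simp only [Pi.zero_apply] at this
      simp only [hx, hy, hout y hy, hin x hx, hout' y hy, indicator_of_mem, Pi.one_apply,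
        not_false_eq_true, indicator_of_notMem, sub_zero, abs_one, abs_of_nonneg this,
        abs_of_nonneg (hg x)]
      ring
    · have := hg'0 y
      rw [hin y hy] at this
      simp only [Pi.zero_apply] at this
      simp only [hx, hy, hout x hx, hin y hy, hout' x hx, indicator_of_mem, Pi.one_apply,
        not_false_eq_true, indicator_of_notMem, zero_sub, abs_neg, abs_one, abs_of_nonneg this,
        abs_of_nonneg (hg y)]
      ring
    · simp [hx, hy, hout, hout']
  have hdec : g = c • S.indicator 1 + g' := by ext v; simp [hg']
  calc K * N g = K * N (c • S.indicator 1 + g') := by rw [← hdec]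
    _ ≤ K * (‖c‖ₑ * N (S.indicator 1) + N g') := by
        gcongr
        exact (hadd _ _).trans (by gcongr; exact hsmul _ _ hc0.le)
    _ = ‖c‖ₑ * (K * N (S.indicator 1)) + K * N g' := by ring
    _ ≤ ‖c‖ₑ * G.variation (S.indicator 1) + G.variation g' := by
        gcongr
        · exact h S subset_rfl
        · exact ih _ hlt hg'0 (fun A hA => h A (hA.trans hsub)) rfl
    _ = G.variation g := hvar.symm

/-! ### The vertex measure on the vertex set -/

section Mass

variable [MeasurableSpace V] [DiscreteMeasurableSpace V]

/-- The vertex measure, as a measure on `V`. -/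
def massMeasure : Measure V := ∑ v, (G.mass v : ℝ≥0∞) • Measure.dirac v

theorem vertexMeasure_apply {s : Set G.Realization} (hs : MeasurableSet s) :
    G.vertexMeasure s = G.massMeasure (G.vertex ⁻¹' s) := by
  simp [vertexMeasure, massMeasure, Measure.finsetSum_apply, hs, MeasurableSet.of_discrete,
    Measure.dirac_apply', indicator]
  rfl

theorem vertexMeasure_eq_map : G.vertexMeasure = G.massMeasure.map G.vertex := by
  ext s hs
  rw [Measure.map_apply Measurable.of_discrete hs, G.vertexMeasure_apply hs]

instance : IsFiniteMeasure G.massMeasure where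
  measure_univ_lt_top := by
    simp [massMeasure, Measure.finsetSum_apply]

omit [DiscreteMeasurableSpace V] in
theorem massMeasure_eq_zero {A : Set V} : G.massMeasure A = 0 ↔ A = ∅ := by
  refine ⟨fun h => ?_, fun h => by simp [h]⟩
  by_contra hne
  obtain ⟨v, hv⟩ := nonempty_iff_ne_empty.2 hne
  have : (G.mass v : ℝ≥0∞) = 0 := by
    simp only [massMeasure, Measure.finsetSum_apply, Finset.sum_eq_zero_iff] at h
    simpa [hv] using h v (Finset.mem_univ v)
  exact (G.mass_pos v).ne' (by exact_mod_cast this)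

theorem norm_eq (p : ℝ≥0∞) {f : G.Realization → ℝ} (hf : Continuous f) :
    G.norm p f = eLpNorm (f ∘ G.vertex) p G.massMeasure := by
  rw [norm, vertexMeasure_eq_map]
  exact eLpNorm_map_measure hf.aestronglyMeasurable Measurable.of_discrete.aemeasurable

/-- The `L^p` norm modulo constants of a function on the vertices. -/
def modNorm (p : ℝ≥0∞) (g : V → ℝ) : ℝ≥0∞ :=
  ⨅ a : ℝ, eLpNorm (fun v => g v - a) p G.massMeasure

theorem normModConst_eq (p : ℝ≥0∞) {f : G.Realization → ℝ} (hf : Continuous f) :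
    G.normModConst p f = G.modNorm p (f ∘ G.vertex) := by
  simp only [normModConst, modNorm]
  exact iInf_congr fun a => G.norm_eq p (hf.sub continuous_const)

theorem eLpNorm_massMeasure_lt_top (p : ℝ≥0∞) (g : V → ℝ) :
    eLpNorm g p G.massMeasure < ⊤ := by
  obtain ⟨C, hC⟩ := (Set.finite_range fun v => ‖g v‖).bddAbove
  exact (MemLp.of_bound (Measurable.of_discrete.aestronglyMeasurable) C
    (Filter.Eventually.of_forall fun v => hC ⟨v, rfl⟩)).2

theorem modNorm_ne_top (p : ℝ≥0∞) (g : V → ℝ) : G.modNorm p g ≠ ⊤ :=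
  ((iInf_le _ 0).trans_lt (G.eLpNorm_massMeasure_lt_top p _)).ne

theorem modNorm_add_le {p : ℝ≥0∞} (hp : 1 ≤ p) (f g : V → ℝ) :
    G.modNorm p (f + g) ≤ G.modNorm p f + G.modNorm p g := by
  simp only [modNorm, ENNReal.iInf_add, ENNReal.add_iInf]
  refine le_iInf₂ fun a b => iInf_le_of_le (a + b) ?_
  refine le_trans (le_of_eq ?_) (eLpNorm_add_le (Measurable.of_discrete.aestronglyMeasurable)
    (Measurable.of_discrete.aestronglyMeasurable) hp)
  congr 1
  ext v
  simp only [Pi.add_apply]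
  ring

omit [DiscreteMeasurableSpace V] in
theorem modNorm_sub_const_le (p : ℝ≥0∞) (g : V → ℝ) (c : ℝ) :
    G.modNorm p g ≤ G.modNorm p (fun v => g v - c) := by
  refine le_iInf fun a => iInf_le_of_le (c + a) (le_of_eq ?_)
  simp only [sub_sub]

omit [DiscreteMeasurableSpace V] in
theorem modNorm_smul_le (p : ℝ≥0∞) (c : ℝ) (g : V → ℝ) :
    G.modNorm p (c • g) ≤ ‖c‖ₑ * G.modNorm p g := by
  rw [modNorm, modNorm, ENNReal.mul_iInf fun h => absurd h enorm_ne_top]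
  refine le_iInf fun a => iInf_le_of_le (c * a) (le_of_eq ?_)
  rw [← eLpNorm_const_smul]
  congr 1
  ext v
  simp [mul_sub]

theorem eLpNorm_indicator_massMeasure {p : ℝ≥0∞} (hp : p ≠ 0) {A : Set V} (hA : A.Nonempty) :
    eLpNorm (A.indicator (1 : V → ℝ)) p G.massMeasure = G.massMeasure A ^ (1 / p.toReal) := by
  have := eLpNorm_indicator_const' (c := (1 : ℝ)) (MeasurableSet.of_discrete (s := A))
    (fun h => hA.ne_empty (G.massMeasure_eq_zero.1 h)) hp
  simpa [← Pi.one_def] using this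

end Mass

/-! ### Functions on the realization -/

theorem continuous_edgeMap (e : E) : Continuous (G.edgeMap e) := by
  let _ : TopologicalSpace V := ⊥
  exact continuous_quot_mk.comp (continuous_inr.comp continuous_sigmaMk)

theorem edgeMap_zero (e : E) :
    G.edgeMap e ⟨0, left_mem_Icc.2 (G.len_pos e).le⟩ = G.vertex (G.src e) :=
  Quot.sound (Glue.src e)

theorem edgeMap_len (e : E) :
    G.edgeMap e ⟨G.len e, right_mem_Icc.2 (G.len_pos e).le⟩ = G.vertex (G.tgt e) :=
  Quot.sound (Glue.tgt e)

theorem alongEdge_of_mem (f : G.Realization → ℝ) (e : E) {s : ℝ} (hs : s ∈ Icc 0 (G.len e)) :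
    G.alongEdge f e s = f (G.edgeMap e ⟨s, hs⟩) :=
  IccExtend_of_mem _ _ hs

theorem alongEdge_zero (f : G.Realization → ℝ) (e : E) :
    G.alongEdge f e 0 = f (G.vertex (G.src e)) := by
  rw [G.alongEdge_of_mem f e (left_mem_Icc.2 (G.len_pos e).le), edgeMap_zero]

theorem alongEdge_len (f : G.Realization → ℝ) (e : E) :
    G.alongEdge f e (G.len e) = f (G.vertex (G.tgt e)) := by
  rw [G.alongEdge_of_mem f e (right_mem_Icc.2 (G.len_pos e).le), edgeMap_len]

theorem continuous_alongEdge {f : G.Realization → ℝ} (hf : Continuous f) (e : E) :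
    Continuous (G.alongEdge f e) :=
  (hf.comp (G.continuous_edgeMap e)).Icc_extend'

theorem gradNorm_eq (f : G.Realization → ℝ) :
    G.gradNorm f =
      ∑ e, (G.weight e : ℝ≥0∞) * ∫⁻ s in Ioo 0 (G.len e), ‖deriv (G.alongEdge f e) s‖ₑ := by
  have hmeas : Measurable fun x => ‖G.grad f x‖ₑ := by
    refine fun s hs => MeasurableSpace.measurableSet_iInf.2 fun e => ?_
    exact (measurable_deriv (G.alongEdge f e)).enorm.comp measurable_subtype_coe hs
  rw [gradNorm, eLpNorm_one_eq_lintegral_enorm, edgeMeasure, lintegral_finsetSum_measure]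
  refine Finset.sum_congr rfl fun e _ => ?_
  rw [lintegral_smul_measure, lintegral_map hmeas (measurable_iff_le_map.2 (iInf_le _ e)), smul_eq_mul]
  congr 1
  exact lintegral_subtype_comap measurableSet_Ioo fun s => ‖deriv (G.alongEdge f e) s‖ₑ

theorem enorm_sub_le_lintegral_deriv {f : ℝ → ℝ} {a b : ℝ} (hab : a ≤ b)
    (hf : ContinuousOn f (Icc a b)) (hd : DifferentiableOn ℝ f (Ioo a b)) :
    ‖f b - f a‖ₑ ≤ ∫⁻ s in Ioo a b, ‖deriv f s‖ₑ := by
  -- Integrability of the derivative is not assumed; if it fails, the right side is infinite.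
  by_cases htop : ∫⁻ s in Ioo a b, ‖deriv f s‖ₑ = ⊤
  · simp [htop]
  have hint : IntegrableOn (deriv f) (Ioo a b) :=
    ⟨(measurable_deriv f).aestronglyMeasurable, lt_top_iff_ne_top.2 htop⟩
  have hftc := intervalIntegral.integral_eq_sub_of_hasDerivAt_of_le hab hf
    (fun x hx => ((hd x hx).differentiableAt (Ioo_mem_nhds hx.1 hx.2)).hasDerivAt)
    ((intervalIntegrable_iff_integrableOn_Ioo_of_le hab).2 hint)
  rw [← hftc, intervalIntegral.integral_of_le hab, integral_Ioc_eq_integral_Ioo]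
  exact enorm_integral_le_lintegral_enorm _

theorem variation_le_gradNorm {f : G.Realization → ℝ} (hf : G.IsC1 f) :
    G.variation (f ∘ G.vertex) ≤ G.gradNorm f := by
  rw [gradNorm_eq, variation]
  gcongr with e
  have := enorm_sub_le_lintegral_deriv (G.len_pos e).le
    (G.continuous_alongEdge hf.1 e).continuousOn (hf.2 e).1
  rwa [alongEdge_zero, alongEdge_len] at this

/-- The function on `𝒢` which is affine on each edge and has prescribed values on the vertices. -/
def interp (g : V → ℝ) : G.Realization → ℝ :=
  Quot.lift (Sum.elim g fun x => g (G.src x.1) + x.2 / G.len x.1 * (g (G.tgt x.1) - g (G.src x.1)))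
    (by
      rintro _ _ (e | e)
      · simp
      · simp [div_self (G.len_pos e).ne'])

theorem interp_vertex (g : V → ℝ) (v : V) : G.interp g (G.vertex v) = g v := rfl

theorem interp_comp_vertex (g : V → ℝ) : G.interp g ∘ G.vertex = g := rfl

theorem interp_edgeMap (g : V → ℝ) (e : E) (s : Icc (0 : ℝ) (G.len e)) :
    G.interp g (G.edgeMap e s) = g (G.src e) + s / G.len e * (g (G.tgt e) - g (G.src e)) := rfl

theorem continuous_interp (g : V → ℝ) : Continuous (G.interp g) := by
  let _ : TopologicalSpace V := ⊥
  have : DiscreteTopology V := ⟨rfl⟩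
  refine continuous_quot_lift _ (continuous_of_discreteTopology.sumElim
    (continuous_sigma fun e => ?_))
  have h : Continuous fun s : Icc (0 : ℝ) (G.len e) =>
      g (G.src e) + s / G.len e * (g (G.tgt e) - g (G.src e)) := by fun_prop
  exact h

theorem deriv_alongEdge_interp (g : V → ℝ) (e : E) {s : ℝ} (hs : s ∈ Ioo 0 (G.len e)) :
    HasDerivAt (G.alongEdge (G.interp g) e) ((g (G.tgt e) - g (G.src e)) / G.len e) s := by
  have h : HasDerivAt (fun s => g (G.src e) + s / G.len e * (g (G.tgt e) - g (G.src e)))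
      (1 / G.len e * (g (G.tgt e) - g (G.src e))) s :=
    (((hasDerivAt_id s).div_const _).mul_const _).const_add _
  rw [one_div_mul_eq_div] at h
  refine h.congr_of_eventuallyEq ?_
  filter_upwards [Ioo_mem_nhds hs.1 hs.2] with t ht
  rw [alongEdge_of_mem _ _ _ (Ioo_subset_Icc_self ht), interp_edgeMap]

theorem isC1_interp (g : V → ℝ) : G.IsC1 (G.interp g) := by
  refine ⟨G.continuous_interp g, fun e => ⟨fun s hs =>
    (G.deriv_alongEdge_interp g e hs).differentiableAt.differentiableWithinAt, ?_⟩⟩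
  exact UniformContinuousOn.congr (f := fun _ => (g (G.tgt e) - g (G.src e)) / G.len e)
    uniformContinuous_const.uniformContinuousOn
    fun s hs => (G.deriv_alongEdge_interp g e hs).deriv.symm

theorem gradNorm_interp (g : V → ℝ) : G.gradNorm (G.interp g) = G.variation g := by
  rw [gradNorm_eq, variation]
  refine Finset.sum_congr rfl fun e _ => ?_
  rw [setLIntegral_congr_fun measurableSet_Ioo
    (fun s hs => by rw [(G.deriv_alongEdge_interp g e hs).deriv])]
  rw [setLIntegral_const, Real.volume_Ioo, sub_zero, ← Real.enorm_eq_ofReal (G.len_pos e).le,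
    ← enorm_mul, div_mul_cancel₀ _ (G.len_pos e).ne']

/-! ### Admissible sets and vertex cuts -/

/-- Connectedness of `[a, b]`: otherwise `U` and the complement of `closure (U ∩ Ioo a b)` would
cover it, yet an open `U` meets `[a, b]` only inside that closure. Approach from the open interval
is what makes an endpoint of an edge count in the area for that very edge. -/
theorem exists_mem_closure_inter_Ioo {U : Set ℝ} (hU : IsOpen U) {a b x y : ℝ} (hab : a < b)
    (hx : x ∈ Icc a b) (hy : y ∈ Icc a b) (hxU : x ∈ U) (hyU : y ∉ U) :
    ∃ s ∈ Icc a b, s ∉ U ∧ s ∈ closure (U ∩ Ioo a b) := by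
  by_contra! H
  have hsub : Icc a b ⊆ U ∪ (closure (U ∩ Ioo a b))ᶜ := fun s hs => by
    by_cases h : s ∈ U
    · exact Or.inl h
    · exact Or.inr (H s hs h)
  obtain ⟨s, hs, hsU, hsc⟩ := isPreconnected_Icc U _ hU isClosed_closure.isOpen_compl hsub
    ⟨x, hx, hxU⟩ ⟨y, hy, H y hy hyU⟩
  refine hsc (hU.inter_closure ⟨hsU, ?_⟩)
  rwa [closure_Ioo hab.ne]

theorem exists_edgeMap_mem_closure {Ω : Set G.Realization} (hΩ : IsOpen Ω) (e : E)
    {x y : Icc (0 : ℝ) (G.len e)} (hx : G.edgeMap e x ∈ Ω) (hy : G.edgeMap e y ∉ Ω) :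
    ∃ s : Icc (0 : ℝ) (G.len e), G.edgeMap e s ∈ frontier Ω ∧
      G.edgeMap e s ∈ closure (Ω ∩ G.edgeInterior e) := by
  have hc := G.continuous_edgeMap e
  set p : ℝ → Icc (0 : ℝ) (G.len e) := projIcc 0 (G.len e) (G.len_pos e).le
  have hp : Continuous fun s => G.edgeMap e (p s) := hc.comp continuous_projIcc
  obtain ⟨s, hs, hsU, hsc⟩ := exists_mem_closure_inter_Ioo (hΩ.preimage hp) (G.len_pos e)
    x.2 y.2 (by simpa [p] using hx) (by simpa [p] using hy)
  have hps : p s = ⟨s, hs⟩ := projIcc_of_mem _ hs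
  have hcl : G.edgeMap e (p s) ∈ closure (Ω ∩ G.edgeInterior e) := by
    refine map_mem_closure (f := fun t => G.edgeMap e (p t)) hp hsc
      fun t ht => ⟨ht.1, ⟨t, ht.2⟩, ?_⟩
    simp only [interiorPoint]
    congr 1
    exact (projIcc_of_mem _ (Ioo_subset_Icc_self ht.2)).symm
  refine ⟨p s, ?_, hcl⟩
  rw [hΩ.frontier_eq]
  exact ⟨closure_mono inter_subset_left hcl, hsU⟩

theorem variation_indicator (A : Set V) :
    G.variation (A.indicator 1) =
      ∑' e : {e : E // ¬ (G.src e ∈ A ↔ G.tgt e ∈ A)}, (G.weight e : ℝ≥0∞) := by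
  rw [variation, ← tsum_fintype (L := .unconditional E), ← tsum_subtype_eq_of_support_subset
    (s := {e | ¬ (G.src e ∈ A ↔ G.tgt e ∈ A)}) ?_]
  · refine tsum_congr fun ⟨e, he⟩ => ?_
    replace he : ¬ (G.src e ∈ A ↔ G.tgt e ∈ A) := he
    by_cases hs : G.src e ∈ A <;> by_cases ht : G.tgt e ∈ A <;> simp_all
  · refine fun e he hiff => he ?_
    by_cases hs : G.src e ∈ A <;> simp_all

/-- Each edge with exactly one end in `Ω` is charged to a term of the area of weight `a_e`: an
interior boundary point, or a pair of a boundary vertex and this edge. Every term remembers its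
edge, so the charging is injective. -/
theorem variation_le_area {Ω : Set G.Realization} (hΩ : IsOpen Ω) :
    G.variation ((G.vertex ⁻¹' Ω).indicator 1) ≤ G.area Ω := by
  let B₁ := {x : G.EdgeInteriors // G.interiorPoint x ∈ frontier Ω}
  let B₂ := Σ v : {v : V // G.vertex v ∈ frontier Ω},
    {e : E // G.vertex v ∈ closure (Ω ∩ G.edgeInterior e)}
  let edge : B₁ ⊕ B₂ → E := Sum.elim (fun x => x.1.1) fun x => x.2.1
  have harea : G.area Ω = ∑' b, (G.weight (edge b) : ℝ≥0∞) := by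
    rw [Summable.tsum_sum ENNReal.summable ENNReal.summable, ENNReal.tsum_sigma']
    rfl
  have hex : ∀ e : {e : E // ¬ (G.src e ∈ G.vertex ⁻¹' Ω ↔ G.tgt e ∈ G.vertex ⁻¹' Ω)},
      ∃ b, edge b = e := by
    rintro ⟨e, he⟩
    obtain ⟨s, hs, hsc⟩ : ∃ s : Icc (0 : ℝ) (G.len e), G.edgeMap e s ∈ frontier Ω ∧
        G.edgeMap e s ∈ closure (Ω ∩ G.edgeInterior e) := by
      simp only [mem_preimage, ← edgeMap_zero, ← edgeMap_len] at he
      by_cases h0 : G.edgeMap e ⟨0, left_mem_Icc.2 (G.len_pos e).le⟩ ∈ Ω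
      · exact G.exists_edgeMap_mem_closure hΩ e h0 fun h => he (iff_of_true h0 h)
      · exact G.exists_edgeMap_mem_closure hΩ e
          (by by_contra h; exact he (iff_of_false h0 h)) h0
    obtain ⟨s, hs0⟩ := s
    rcases eq_or_lt_of_le hs0.1 with rfl | h0
    · rw [edgeMap_zero] at hs hsc
      exact ⟨Sum.inr ⟨⟨_, hs⟩, ⟨e, hsc⟩⟩, rfl⟩
    rcases eq_or_lt_of_le hs0.2 with rfl | h1
    · rw [edgeMap_len] at hs hsc
      exact ⟨Sum.inr ⟨⟨_, hs⟩, ⟨e, hsc⟩⟩, rfl⟩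
    exact ⟨Sum.inl ⟨⟨e, s, h0, h1⟩, hs⟩, rfl⟩
  choose φ hφ using hex
  have hinj : Function.Injective φ := fun e e' h => by
    rw [Subtype.ext_iff, ← hφ, ← hφ, h]
  rw [variation_indicator, harea]
  simp only [← hφ]
  exact ENNReal.tsum_comp_le_tsum_of_injective hinj _

/-- Take the superlevel set at height `1/2` of the interpolated indicator. The value `1/2` occurs
only at midpoints of edges joining `A` to its complement, so no vertex lies on the boundary. -/
theorem exists_admissible (A : Set V) :
    ∃ Ω, G.Admissible Ω ∧ G.vertex ⁻¹' Ω = A ∧ G.area Ω ≤ G.variation (A.indicator 1) := by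
  set f := G.interp (A.indicator 1) with hf
  have hfc : Continuous f := G.continuous_interp _
  have hfr : frontier {x | 1 / 2 < f x} ⊆ {x | f x = 1 / 2} := fun x hx =>
    (frontier_lt_subset_eq continuous_const hfc hx : (1 / 2 : ℝ) = f x).symm
  have hv : ∀ v, f (G.vertex v) ≠ 1 / 2 := fun v => by
    rw [hf, interp_vertex]
    by_cases h : v ∈ A <;> simp [h]
  have hmid : ∀ e s, f (G.edgeMap e s) = 1 / 2 →
      ¬ (G.src e ∈ A ↔ G.tgt e ∈ A) ∧ (s : ℝ) = G.len e / 2 := by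
    intro e s h
    have hl := G.len_pos e
    rw [hf, interp_edgeMap] at h
    by_cases hs : G.src e ∈ A <;> by_cases ht : G.tgt e ∈ A <;> simp [hs, ht] at h ⊢ <;>
      field_simp at h <;> linarith
  refine ⟨{x | 1 / 2 < f x}, ⟨isOpen_lt continuous_const hfc, ?_⟩, ?_, ?_⟩
  · refine (finite_range fun e : E => G.edgeMap e ⟨G.len e / 2, by
      have := G.len_pos e; constructor <;> linarith⟩).subset fun x hx => ?_
    have hx' := hfr hx
    induction x using Quot.ind with
    | mk x =>
    rcases x with v | ⟨e, s⟩
    · exact absurd hx' (hv v)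
    · refine ⟨e, ?_⟩
      exact congrArg (G.edgeMap e) (Subtype.ext (hmid e s hx').2.symm)
  · ext v
    rw [mem_preimage, mem_ofPred_eq, hf, interp_vertex]
    by_cases h : v ∈ A <;> simp [h]; norm_num
  · have : IsEmpty {v : V // G.vertex v ∈ frontier {x | 1 / 2 < f x}} :=
      ⟨fun v => hv v.1 (hfr v.2)⟩
    rw [area, tsum_empty (β := {v : V // G.vertex v ∈ frontier {x | 1 / 2 < f x}}), add_zero,
      variation_indicator]
    let φ : {x : G.EdgeInteriors // G.interiorPoint x ∈ frontier {x | 1 / 2 < f x}} →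
        {e : E // ¬ (G.src e ∈ A ↔ G.tgt e ∈ A)} :=
      fun x => ⟨x.1.1, (hmid x.1.1 _ (hfr x.2)).1⟩
    have hφ : Function.Injective φ := by
      rintro ⟨⟨e, s⟩, hs⟩ ⟨⟨e', s'⟩, hs'⟩ h
      obtain rfl : e = e' := congrArg Subtype.val h
      have h1 := (hmid e _ (hfr hs)).2
      have h2 := (hmid e _ (hfr hs')).2
      obtain rfl : s = s' := Subtype.ext (h1.trans h2.symm)
      rfl
    exact ENNReal.tsum_comp_le_tsum_of_injective hφ fun e => (G.weight e : ℝ≥0∞)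

/-! ### The isoperimetric factor -/

open Classical in
/-- The factor `(x^{1-ν} + y^{1-ν})^{1/ν}`, with its limit for `ν = ∞`. -/
def isoFactor (ν x y : ℝ≥0∞) : ℝ≥0∞ :=
  if ν = ⊤ then max x⁻¹ y⁻¹ else (x ^ (1 - ν.toReal) + y ^ (1 - ν.toReal)) ^ (1 / ν.toReal)

theorem one_le_enorm_one_sub_add (a : ℝ) : 1 ≤ ‖1 - a‖ₑ + ‖a‖ₑ := by
  simpa using enorm_add_le (1 - a) a

section Factor

variable {x y : ℝ≥0∞}

theorem isoFactor_ne_top {ν : ℝ≥0∞} (hx : x ≠ 0) (hx' : x ≠ ⊤) (hy : y ≠ 0) (hy' : y ≠ ⊤) :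
    isoFactor ν x y ≠ ⊤ := by
  unfold isoFactor
  split_ifs
  · exact (max_lt (by simpa [pos_iff_ne_zero] using hx)
      (by simpa [pos_iff_ne_zero] using hy)).ne
  · refine ENNReal.rpow_ne_top_of_nonneg (by positivity) ?_
    simp [ENNReal.add_eq_top, ENNReal.rpow_eq_top_iff, hx, hx', hy, hy']

theorem min_rpow_le_isoFactor {ν : ℝ≥0∞} (hν : 1 ≤ ν) :
    min x y ^ ((ν⁻¹).toReal - 1) ≤ isoFactor ν x y := by
  unfold isoFactor
  split_ifs with h
  · subst h
    simp only [ENNReal.inv_top, ENNReal.toReal_zero, zero_sub, ENNReal.rpow_neg_one]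
    rcases le_total x y with h | h <;> simp [h]
  · have h1 : 1 ≤ ν.toReal := by simpa using ENNReal.toReal_mono h hν
    have he : (ν⁻¹).toReal - 1 = (1 - ν.toReal) * (1 / ν.toReal) := by
      rw [ENNReal.toReal_inv]; field_simp
    rw [he, ENNReal.rpow_mul]
    gcongr
    rcases le_total x y with h | h <;> simp [h]

/-- For finite `ν` the exponent `1 - ν` is nonpositive, so both summands are at most the one at `min
x y`; the two copies produce `2 ^ (1/ν)`. -/
theorem isoFactor_le {ν : ℝ≥0∞} (hν : 1 ≤ ν) :
    isoFactor ν x y ≤ 2 ^ (ν⁻¹).toReal * min x y ^ ((ν⁻¹).toReal - 1) := by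
  unfold isoFactor
  split_ifs with h
  · subst h
    simp only [ENNReal.inv_top, ENNReal.toReal_zero, zero_sub, ENNReal.rpow_neg_one,
      ENNReal.rpow_zero, one_mul]
    rcases le_total x y with h | h <;> simp [h]
  · have h1 : 1 ≤ ν.toReal := by simpa using ENNReal.toReal_mono h hν
    have he : (ν⁻¹).toReal - 1 = (1 - ν.toReal) * (1 / ν.toReal) := by
      rw [ENNReal.toReal_inv]; field_simp
    rw [he, ENNReal.rpow_mul, ENNReal.toReal_inv, ← one_div,
      ← ENNReal.mul_rpow_of_nonneg _ _ (by positivity), two_mul]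
    gcongr ?_ ^ _
    have hmono : ∀ z, min x y ≤ z → z ^ (1 - ν.toReal) ≤ min x y ^ (1 - ν.toReal) := by
      intro z hz
      rw [← neg_sub, ENNReal.rpow_neg, ENNReal.rpow_neg, ENNReal.inv_le_inv]
      exact ENNReal.rpow_le_rpow hz (by linarith)
    exact add_le_add (hmono x (min_le_left x y)) (hmono y (min_le_right x y))

/-- The two-point case of Hölder's inequality. -/
theorem inv_isoFactor_le {p q : ℝ} (hpq : p.HolderConjugate q) (hx : x ≠ 0) (hx' : x ≠ ⊤)
    (hy : y ≠ 0) (hy' : y ≠ ⊤) {s t : ℝ≥0∞} (hst : 1 ≤ s + t) :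
    ((x ^ (1 - q) + y ^ (1 - q)) ^ (1 / q))⁻¹ ≤ (x * s ^ p + y * t ^ p) ^ (1 / p) := by
  have hp := hpq.pos
  have hq : -(1 / p) * q = 1 - q := by
    have := hpq.symm.sub_one_mul_conj
    have h2 := hpq.ne_zero
    field_simp
    linarith
  -- The products of corresponding entries are `s` and `t`, so the left side of Hölder is `s + t ≥
  -- 1`.
  have key := ENNReal.inner_le_Lp_mul_Lq (Finset.univ : Finset (Fin 2))
    ![x ^ (1 / p) * s, y ^ (1 / p) * t] ![x ^ (-(1 / p)), y ^ (-(1 / p))] hpq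
  have hcancel : ∀ z r : ℝ≥0∞, z ≠ 0 → z ≠ ⊤ → z ^ (1 / p) * r * z ^ (-(1 / p)) = r := by
    intro z r hz hz'
    rw [mul_right_comm, ← ENNReal.rpow_add _ _ hz hz']
    simp
  simp only [Fin.sum_univ_two, Matrix.cons_val_zero, Matrix.cons_val_one,
    hcancel x s hx hx', hcancel y t hy hy', ENNReal.mul_rpow_of_nonneg _ _ hp.le,
    ← ENNReal.rpow_mul, hq, one_div_mul_cancel hp.ne', ENNReal.rpow_one] at key
  rw [← one_div]
  exact ENNReal.div_le_of_le_mul (hst.trans key)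

/-- The equality case of the two-point Hölder inequality. -/
theorem exists_le_inv_isoFactor {p q : ℝ} (hpq : p.HolderConjugate q) (hx : x ≠ 0) (hx' : x ≠ ⊤)
    (hy : y ≠ 0) (hy' : y ≠ ⊤) :
    ∃ a : ℝ, (x * ‖1 - a‖ₑ ^ p + y * ‖a‖ₑ ^ p) ^ (1 / p) ≤
      ((x ^ (1 - q) + y ^ (1 - q)) ^ (1 / q))⁻¹ := by
  have hp := hpq.pos
  set X := x ^ (1 - q) with hX
  set Y := y ^ (1 - q) with hY
  have hX0 : X ≠ 0 := (ENNReal.rpow_pos (pos_iff_ne_zero.2 hx) hx').ne'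
  have hXt : X ≠ ⊤ := ENNReal.rpow_ne_top_of_ne_zero hx hx'
  have hYt : Y ≠ ⊤ := ENNReal.rpow_ne_top_of_ne_zero hy hy'
  set Z := X + Y with hZ
  have hZ0 : Z ≠ 0 := by simp [hZ, hX0]
  have hZt : Z ≠ ⊤ := by simp [hZ, hXt, hYt]
  have hXZ : X / Z ≠ ⊤ := ENNReal.div_ne_top hXt hZ0
  have hYZ : Y / Z ≠ ⊤ := ENNReal.div_ne_top hYt hZ0
  have hsum : (X / Z).toReal + (Y / Z).toReal = 1 := by
    rw [← ENNReal.toReal_add hXZ hYZ, ← ENNReal.add_div, ENNReal.div_self hZ0 hZt,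
      ENNReal.toReal_one]
  -- With this `a`, the values `1 - a` and `a` are proportional to `x ^ (1 - q)` and `y ^ (1 - q)`,
  -- the equality case of Hölder.
  refine ⟨(Y / Z).toReal, ?_⟩
  rw [← eq_sub_of_add_eq hsum]
  have hen : ∀ z : ℝ≥0∞, z ≠ ⊤ → ‖z.toReal‖ₑ = z := fun z hz => by
    rw [Real.enorm_eq_ofReal ENNReal.toReal_nonneg, ENNReal.ofReal_toReal hz]
  have hpow : ∀ z : ℝ≥0∞, z ≠ 0 → z ≠ ⊤ → z * (z ^ (1 - q) / Z) ^ p = z ^ (1 - q) / Z ^ p := by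
    intro z hz hz'
    rw [ENNReal.div_rpow_of_nonneg _ _ hp.le, ← ENNReal.rpow_mul, ← mul_div_assoc]
    congr 1
    nth_rw 1 [← ENNReal.rpow_one z]
    rw [← ENNReal.rpow_add _ _ hz hz']
    congr 1
    have := hpq.sub_one_mul_conj
    linarith
  rw [hen _ hXZ, hen _ hYZ, hpow x hx hx', hpow y hy hy', ← ENNReal.add_div, ← hZ,
    ENNReal.div_rpow_of_nonneg _ _ (by positivity), ← ENNReal.rpow_mul,
    mul_one_div_cancel hp.ne', ENNReal.rpow_one, ← ENNReal.rpow_neg]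
  have he : -(1 / q) = 1 / p - 1 := by
    have := hpq.inv_add_inv_eq_one
    simp only [one_div]; linarith
  rw [he, ENNReal.rpow_sub _ _ hZ0 hZt, ENNReal.rpow_one]

end Factor

/-! ### Distance from an indicator to the constants. -/

section ModNorm

variable [MeasurableSpace V] [DiscreteMeasurableSpace V]

theorem lintegral_indicator_sub_rpow (A : Set V) (a p : ℝ) :
    ∫⁻ v, ‖A.indicator 1 v - a‖ₑ ^ p ∂G.massMeasure =
      G.massMeasure A * ‖1 - a‖ₑ ^ p + G.massMeasure Aᶜ * ‖a‖ₑ ^ p := by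
  rw [← lintegral_add_compl _ (MeasurableSet.of_discrete (s := A)),
    setLIntegral_congr_fun (g := fun _ => ‖1 - a‖ₑ ^ p) MeasurableSet.of_discrete
      (fun v hv => by simp [hv]),
    setLIntegral_congr_fun (s := Aᶜ) (g := fun _ => ‖a‖ₑ ^ p) MeasurableSet.of_discrete
      (fun v hv => by simp [notMem_of_mem_compl hv]),
    setLIntegral_const, setLIntegral_const, mul_comm, mul_comm (‖a‖ₑ ^ p)]

-- Every vertex has positive mass, so the essential supremum is a true supremum.
omit [DiscreteMeasurableSpace V] in
theorem enorm_le_eLpNorm_top (g : V → ℝ) (v : V) : ‖g v‖ₑ ≤ eLpNorm g ⊤ G.massMeasure := by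
  have h : G.massMeasure {v | ¬ ‖g v‖ₑ ≤ eLpNorm g ⊤ G.massMeasure} = 0 := by
    rw [eLpNorm_exponent_top]
    exact enorm_ae_le_eLpNormEssSup g G.massMeasure
  by_contra hv
  exact (Set.ext_iff.1 (G.massMeasure_eq_zero.1 h) v).1 hv

theorem modNorm_indicator {ν : ℝ≥0∞} (hν : 1 ≤ ν) {A : Set V} (hA : A.Nonempty)
    (hA' : Aᶜ.Nonempty) :
    G.modNorm ν.conjExponent (A.indicator 1) =
      (isoFactor ν (G.massMeasure A) (G.massMeasure Aᶜ))⁻¹ := by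
  have hx : G.massMeasure A ≠ 0 := fun h => hA.ne_empty (G.massMeasure_eq_zero.1 h)
  have hy : G.massMeasure Aᶜ ≠ 0 := fun h => hA'.ne_empty (G.massMeasure_eq_zero.1 h)
  have hx' := measure_ne_top G.massMeasure A
  have hy' := measure_ne_top G.massMeasure Aᶜ
  have hF : ∀ p : ℝ≥0∞, p ≠ 0 → p ≠ ⊤ → ∀ a : ℝ,
      eLpNorm (fun v => A.indicator 1 v - a) p G.massMeasure =
      (G.massMeasure A * ‖1 - a‖ₑ ^ p.toReal + G.massMeasure Aᶜ * ‖a‖ₑ ^ p.toReal) ^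
        (1 / p.toReal) := fun p h0 ht a => by
    rw [eLpNorm_eq_lintegral_rpow_enorm_toReal h0 ht, lintegral_indicator_sub_rpow]
  unfold isoFactor
  split_ifs with hνt
  -- Dual exponent `1`: the distance is at least the smaller mass, attained at `a = 0` or `a = 1`.
  · subst hνt
    have : ENNReal.conjExponent ⊤ = 1 := by simp [ENNReal.conjExponent]
    simp only [modNorm, this, hF 1 one_ne_zero ENNReal.one_ne_top, ENNReal.toReal_one,
      ENNReal.rpow_one, div_one]
    have hinv : (max (G.massMeasure A)⁻¹ (G.massMeasure Aᶜ)⁻¹)⁻¹ =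
        min (G.massMeasure A) (G.massMeasure Aᶜ) := by
      rcases le_total (G.massMeasure A) (G.massMeasure Aᶜ) with h | h <;> simp [h]
    rw [hinv]
    refine le_antisymm (le_min (iInf_le_of_le 0 ?_) (iInf_le_of_le 1 ?_)) (le_iInf fun a => ?_)
    · simp
    · simp
    · calc min (G.massMeasure A) (G.massMeasure Aᶜ)
          ≤ min (G.massMeasure A) (G.massMeasure Aᶜ) * (‖1 - a‖ₑ + ‖a‖ₑ) :=
            le_mul_of_one_le_right' (one_le_enorm_one_sub_add a)
        _ ≤ _ := by
            rw [mul_add]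
            gcongr
            · exact min_le_left _ _
            · exact min_le_right _ _
  -- For `ν = 1` the dual exponent is `∞`, and the midpoint `a = 1/2` is optimal.
  rcases hν.eq_or_lt with rfl | hν1
  · have : ENNReal.conjExponent 1 = ⊤ := by simp [ENNReal.conjExponent]
    simp only [modNorm, this, ENNReal.toReal_one, sub_self, ENNReal.rpow_zero, div_one,
      ENNReal.rpow_one, one_add_one_eq_two]
    refine le_antisymm (iInf_le_of_le (1 / 2) ?_) (le_iInf fun a => ?_)
    · rw [eLpNorm_exponent_top]
      refine eLpNormEssSup_le_of_ae_enorm_bound (Filter.Eventually.of_forall fun v => ?_)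
      have h2 : ‖(1 / 2 : ℝ)‖ₑ = 2⁻¹ := by
        rw [Real.enorm_eq_ofReal (by norm_num), one_div,
          ENNReal.ofReal_inv_of_pos two_pos, ENNReal.ofReal_ofNat]
      by_cases hv : v ∈ A
      · simp only [hv, indicator_of_mem, Pi.one_apply]
        rw [show (1 - 1 / 2 : ℝ) = 1 / 2 by norm_num, h2]
      · simp only [hv, not_false_eq_true, indicator_of_notMem, zero_sub, enorm_neg, h2, le_refl]
    · obtain ⟨v, hv⟩ := hA
      obtain ⟨w, hw⟩ := hA'
      have h1 := G.enorm_le_eLpNorm_top (fun v => A.indicator 1 v - a) v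
      have h2 := G.enorm_le_eLpNorm_top (fun v => A.indicator 1 v - a) w
      simp only [hv, indicator_of_mem, Pi.one_apply] at h1
      simp only [indicator_of_notMem hw, zero_sub, enorm_neg] at h2
      rw [← one_div]
      refine ENNReal.div_le_of_le_mul ?_
      rw [mul_two]
      exact (one_le_enorm_one_sub_add a).trans (add_le_add h1 h2)
  · have hc : ν.HolderConjugate ν.conjExponent := .conjExponent hν
    have hp0 : ν.conjExponent ≠ 0 := by simp [ENNReal.conjExponent]
    have hpt : ν.conjExponent ≠ ⊤ := by
      simpa [ENNReal.conjExponent, tsub_eq_zero_iff_le] using hν1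
    have hpq : ν.conjExponent.toReal.HolderConjugate ν.toReal :=
      (ENNReal.HolderConjugate.toReal_of_ne_top hνt hpt).symm
    simp only [modNorm, hF _ hp0 hpt]
    refine le_antisymm ?_ (le_iInf fun a =>
      inv_isoFactor_le hpq hx hx' hy hy' (one_le_enorm_one_sub_add a))
    obtain ⟨a, ha⟩ := exists_le_inv_isoFactor hpq hx hx' hy hy'
    exact iInf_le_of_le a ha

end ModNorm

/-! ### Isoperimetric and Sobolev constants -/

section Constants

variable [MeasurableSpace V] [DiscreteMeasurableSpace V]

-- Transfers the infimum to vertex cuts for both constants at once: the factor `Φ` depends only on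
-- the two masses, and the ratio is monotone in the area.
open Classical in
theorem iInf_admissible_eq {R : Set G.Realization → ℝ≥0∞} {Φ : ℝ≥0∞ → ℝ≥0∞ → ℝ≥0∞}
    (hR : ∀ Ω, R Ω = if G.vertexMeasure Ω = 0 ∨ G.vertexMeasure Ωᶜ = 0 then ⊤ else
      G.area Ω * Φ (G.vertexMeasure Ω) (G.vertexMeasure Ωᶜ)) :
    ⨅ (Ω) (_ : G.Admissible Ω), R Ω = ⨅ (A : Set V) (_ : A.Nonempty) (_ : Aᶜ.Nonempty),
      G.variation (A.indicator 1) * Φ (G.massMeasure A) (G.massMeasure Aᶜ) := by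
  have hm : ∀ Ω, IsOpen Ω → G.vertexMeasure Ω = G.massMeasure (G.vertex ⁻¹' Ω) ∧
      G.vertexMeasure Ωᶜ = G.massMeasure (G.vertex ⁻¹' Ω)ᶜ := fun Ω hΩ =>
    ⟨G.vertexMeasure_apply hΩ.measurableSet, G.vertexMeasure_apply hΩ.measurableSet.compl⟩
  refine le_antisymm (le_iInf fun A => le_iInf₂ fun hA hA' => ?_) (le_iInf₂ fun Ω hΩ => ?_)
  · obtain ⟨Ω, hΩ, hΩA, harea⟩ := G.exists_admissible A
    refine iInf₂_le_of_le Ω hΩ ?_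
    rw [hR, (hm Ω hΩ.1).1, (hm Ω hΩ.1).2, hΩA, if_neg]
    · gcongr
    · simp only [massMeasure_eq_zero, not_or]
      exact ⟨hA.ne_empty, hA'.ne_empty⟩
  · rw [hR, (hm Ω hΩ.1).1, (hm Ω hΩ.1).2]
    split_ifs with h
    · exact le_top
    simp only [massMeasure_eq_zero, not_or, ← nonempty_iff_ne_empty] at h
    refine iInf_le_of_le _ (iInf₂_le_of_le h.1 h.2 ?_)
    gcongr
    exact G.variation_le_area hΩ.1

theorem isoConst_eq (ν : ℝ≥0∞) :
    G.isoConst ν = ⨅ (A : Set V) (_ : A.Nonempty) (_ : Aᶜ.Nonempty), G.variation (A.indicator 1) *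
      min (G.massMeasure A) (G.massMeasure Aᶜ) ^ ((ν⁻¹).toReal - 1) :=
  G.iInf_admissible_eq (Φ := fun x y => min x y ^ ((ν⁻¹).toReal - 1)) fun _ => rfl

theorem isoConst'_eq (ν : ℝ≥0∞) :
    G.isoConst' ν = ⨅ (A : Set V) (_ : A.Nonempty) (_ : Aᶜ.Nonempty), G.variation (A.indicator 1) *
      isoFactor ν (G.massMeasure A) (G.massMeasure Aᶜ) :=
  G.iInf_admissible_eq (Φ := isoFactor ν) fun Ω => by
    simp only [isoRatio', isoFactor, mul_ite]

/-! ### Sobolev inequality modulo constants. -/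

theorem isoConst'_mul_modNorm_le {ν : ℝ≥0∞} (hν : 1 ≤ ν) (g : V → ℝ) :
    G.isoConst' ν * G.modNorm ν.conjExponent g ≤ G.variation g := by
  have hp : 1 ≤ ν.conjExponent := le_self_add
  have hA : ∀ A : Set V, G.isoConst' ν * G.modNorm ν.conjExponent (A.indicator 1) ≤
      G.variation (A.indicator 1) := by
    intro A
    -- The cuts `∅` and `V` are absent from the infimum, but their indicators are constant; `⊤ * 0 =
    -- 0` covers an infinite constant.
    have hconst : ∀ c : ℝ, G.modNorm ν.conjExponent (fun _ => c) = 0 := fun c =>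
      le_antisymm (iInf_le_of_le c (by simp)) zero_le
    rcases A.eq_empty_or_nonempty with rfl | hne
    · have : ((∅ : Set V).indicator 1 : V → ℝ) = fun _ => 0 := by ext; simp
      rw [this, hconst, mul_zero]
      exact zero_le
    rcases Aᶜ.eq_empty_or_nonempty with he | hne'
    · have : (A.indicator 1 : V → ℝ) = fun _ => 1 := by
        rw [compl_empty_iff.1 he]; ext; simp
      rw [this, hconst, mul_zero]
      exact zero_le
    have hx := mt G.massMeasure_eq_zero.1 hne.ne_empty
    have hy := mt G.massMeasure_eq_zero.1 hne'.ne_empty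
    rw [G.modNorm_indicator hν hne hne', ← div_eq_mul_inv]
    refine ENNReal.div_le_of_le_mul ?_
    rw [isoConst'_eq]
    exact iInf_le_of_le A (iInf₂_le hne hne')
  -- Shifting by a lower bound gives the nonnegativity the layer-cake argument needs, without
  -- changing the variation.
  obtain ⟨m, hm⟩ : ∃ m, ∀ v, m ≤ g v := by
    obtain ⟨m, hm⟩ := (finite_range g).bddBelow
    exact ⟨m, fun v => hm ⟨v, rfl⟩⟩
  calc G.isoConst' ν * G.modNorm ν.conjExponent g
      ≤ G.isoConst' ν * G.modNorm ν.conjExponent (fun v => g v - m) := by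
        gcongr
        exact G.modNorm_sub_const_le _ g m
    _ ≤ G.variation (fun v => g v - m) :=
        G.mul_le_variation_of_nonneg (G.modNorm_add_le hp) (fun c f _ => G.modNorm_smul_le _ c f) _
          (fun v => sub_nonneg.2 (hm v)) fun A _ => hA A
    _ = G.variation g := G.variation_sub_const g m

theorem isoConst'_eq_sobolevConst {ν : ℝ≥0∞} (hν : 1 ≤ ν) :
    G.isoConst' ν = G.sobolevConst ν := by
  refine le_antisymm (le_iInf fun f => le_iInf₂ fun hf hne => ?_) ?_
  · rw [normModConst_eq _ _ hf.1] at hne ⊢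
    rw [ENNReal.le_div_iff_mul_le (Or.inl hne) (Or.inl (G.modNorm_ne_top _ _))]
    exact (G.isoConst'_mul_modNorm_le hν _).trans (G.variation_le_gradNorm hf)
  · rw [isoConst'_eq]
    refine le_iInf fun A => le_iInf₂ fun hA hA' => ?_
    have hx := mt G.massMeasure_eq_zero.1 hA.ne_empty
    have hy := mt G.massMeasure_eq_zero.1 hA'.ne_empty
    have hN : G.normModConst ν.conjExponent (G.interp (A.indicator 1)) =
        (isoFactor ν (G.massMeasure A) (G.massMeasure Aᶜ))⁻¹ := by
      rw [normModConst_eq _ _ (G.continuous_interp _), interp_comp_vertex,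
        G.modNorm_indicator hν hA hA']
    refine iInf_le_of_le (G.interp (A.indicator 1)) (iInf₂_le_of_le (G.isC1_interp _) ?_ ?_)
    · rw [hN]
      exact ENNReal.inv_ne_zero.2
        (isoFactor_ne_top hx (measure_ne_top _ _) hy (measure_ne_top _ _))
    · rw [hN, gradNorm_interp, div_eq_mul_inv, inv_inv]

/-! ### Sobolev inequality for split functions. -/

theorem one_div_toReal_conjExponent {ν : ℝ≥0∞} (hν : 1 ≤ ν) :
    1 / ν.conjExponent.toReal = 1 - (ν⁻¹).toReal := by
  have hc : ν.HolderConjugate ν.conjExponent := .conjExponent hν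
  have h := ENNReal.HolderConjugate.inv_add_inv_eq_one ν ν.conjExponent
  have h1 : ν⁻¹ ≠ ⊤ := fun ht => by simp [ht] at h
  have h2 : ν.conjExponent⁻¹ ≠ ⊤ := fun ht => by simp [ht] at h
  have := congrArg ENNReal.toReal h
  -- When the dual exponent is `∞`, its `toReal` is `0` and `1 / 0 = 0`, so the formula persists.
  rw [ENNReal.toReal_add h1 h2, ENNReal.toReal_inv ν.conjExponent, ENNReal.toReal_one] at this
  rw [one_div]
  linarith

theorem isoConst_mul_eLpNorm_indicator_le {ν : ℝ≥0∞} (hν : 1 ≤ ν) {A : Set V}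
    (hA : G.massMeasure A ≤ G.massMeasure univ / 2) :
    G.isoConst ν * eLpNorm (A.indicator (1 : V → ℝ)) ν.conjExponent G.massMeasure ≤
      G.variation (A.indicator 1) := by
  rcases A.eq_empty_or_nonempty with rfl | hne
  · simp
  have hx := mt G.massMeasure_eq_zero.1 hne.ne_empty
  have hle : G.massMeasure A ≤ G.massMeasure Aᶜ := by
    have h := measure_add_measure_compl (μ := G.massMeasure) (MeasurableSet.of_discrete (s := A))
    rw [← h, ENNReal.le_div_iff_mul_le (by simp) (by simp), mul_two] at hA
    exact (ENNReal.add_le_add_iff_left (measure_ne_top _ A)).1 hA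
  have hne' : Aᶜ.Nonempty := by
    rw [nonempty_iff_ne_empty]
    intro he
    rw [he, measure_empty] at hle
    exact hx (le_antisymm hle zero_le)
  have hp : ν.conjExponent ≠ 0 := by simp [ENNReal.conjExponent]
  rw [G.eLpNorm_indicator_massMeasure hp hne, one_div_toReal_conjExponent hν, ← neg_sub,
    ENNReal.rpow_neg, ← div_eq_mul_inv]
  refine ENNReal.div_le_of_le_mul ?_
  rw [isoConst_eq]
  refine iInf_le_of_le A (iInf₂_le_of_le hne hne' ?_)
  rw [min_eq_left hle]

theorem isoConst_mul_eLpNorm_le_of_nonneg {ν : ℝ≥0∞} (hν : 1 ≤ ν) {h : V → ℝ} (h0 : 0 ≤ h)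
    (hh : G.massMeasure {v | 0 < h v} ≤ G.massMeasure univ / 2) :
    G.isoConst ν * eLpNorm h ν.conjExponent G.massMeasure ≤ G.variation h :=
  G.mul_le_variation_of_nonneg (N := fun h => eLpNorm h ν.conjExponent G.massMeasure)
    (fun _ _ => eLpNorm_add_le Measurable.of_discrete.aestronglyMeasurable
      Measurable.of_discrete.aestronglyMeasurable le_self_add)
    (fun c f _ => (eLpNorm_const_smul c f _ _).le) _ h0
    fun _ hA => G.isoConst_mul_eLpNorm_indicator_le hν ((measure_mono hA).trans hh)

/-- Positive and negative parts are treated separately: their norms bound that of `g` from above,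
while their variations add up exactly. -/
theorem isoConst_mul_eLpNorm_le {ν : ℝ≥0∞} (hν : 1 ≤ ν) {g : V → ℝ}
    (hpos : G.massMeasure {v | 0 < g v} ≤ G.massMeasure univ / 2)
    (hneg : G.massMeasure {v | g v < 0} ≤ G.massMeasure univ / 2) :
    G.isoConst ν * eLpNorm g ν.conjExponent G.massMeasure ≤ G.variation g := by
  have hdec : g = (fun v => max (g v) 0) - fun v => max (-g v) 0 := by
    ext v
    simp only [Pi.sub_apply]
    rcases le_total (g v) 0 with h | h <;> simp [h]
  have hsub : eLpNorm g ν.conjExponent G.massMeasure ≤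
      eLpNorm (fun v => max (g v) 0) ν.conjExponent G.massMeasure +
        eLpNorm (fun v => max (-g v) 0) ν.conjExponent G.massMeasure := by
    nth_rw 1 [hdec]
    exact eLpNorm_sub_le Measurable.of_discrete.aestronglyMeasurable
      Measurable.of_discrete.aestronglyMeasurable le_self_add
  rw [variation_eq_pos_add_neg]
  refine (mul_le_mul_right hsub _).trans ?_
  rw [mul_add]
  refine add_le_add (G.isoConst_mul_eLpNorm_le_of_nonneg hν (fun v => le_max_right _ _) ?_)
    (G.isoConst_mul_eLpNorm_le_of_nonneg hν (fun v => le_max_right _ _) ?_)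
  · simpa using hpos
  · simpa using hneg

theorem isoConst_mul_norm_le {ν : ℝ≥0∞} (hν : 1 ≤ ν) {f : G.Realization → ℝ} (hf : G.IsC1 f)
    (hs : G.IsSplit f) : G.isoConst ν * G.norm ν.conjExponent f ≤ G.gradNorm f := by
  obtain ⟨hpos, hneg⟩ := hs
  rw [G.vertexMeasure_apply (isOpen_lt continuous_const hf.1).measurableSet,
    G.vertexMeasure_apply MeasurableSet.univ, preimage_univ] at hpos
  rw [G.vertexMeasure_apply (isOpen_lt hf.1 continuous_const).measurableSet,
    G.vertexMeasure_apply MeasurableSet.univ, preimage_univ] at hneg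
  rw [G.norm_eq _ hf.1]
  exact (G.isoConst_mul_eLpNorm_le hν hpos hneg).trans (G.variation_le_gradNorm hf)

theorem splitSobolevConst_le_of_massMeasure_le {ν : ℝ≥0∞} (hν : 1 ≤ ν) {A : Set V}
    (hA : A.Nonempty) (hle : G.massMeasure A ≤ G.massMeasure Aᶜ) :
    G.splitSobolevConst ν ≤
      G.variation (A.indicator 1) * G.massMeasure A ^ ((ν⁻¹).toReal - 1) := by
  have hx := mt G.massMeasure_eq_zero.1 hA.ne_empty
  have hp : ν.conjExponent ≠ 0 := by simp [ENNReal.conjExponent]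
  set f := G.interp (A.indicator 1) with hf
  have hfc : Continuous f := G.continuous_interp _
  have hpos : G.vertex ⁻¹' {x | 0 < f x} = A := by
    ext v
    rw [mem_preimage, mem_ofPred_eq, hf, interp_vertex]
    by_cases h : v ∈ A <;> simp [h]
  have hneg : G.vertex ⁻¹' {x | f x < 0} = ∅ := by
    ext v
    rw [mem_preimage, mem_ofPred_eq, hf, interp_vertex]
    by_cases h : v ∈ A <;> simp [h]
  have hsplit : G.IsSplit f := by
    unfold IsSplit
    rw [G.vertexMeasure_apply (isOpen_lt continuous_const hfc).measurableSet,
      G.vertexMeasure_apply (isOpen_lt hfc continuous_const).measurableSet, hpos, hneg,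
      G.vertexMeasure_apply MeasurableSet.univ, preimage_univ, measure_empty]
    refine ⟨?_, zero_le⟩
    rw [← measure_add_measure_compl (μ := G.massMeasure) (MeasurableSet.of_discrete (s := A)),
      ENNReal.le_div_iff_mul_le (by simp) (by simp), mul_two]
    gcongr
  have hN : G.norm ν.conjExponent f = (G.massMeasure A ^ ((ν⁻¹).toReal - 1))⁻¹ := by
    rw [G.norm_eq _ hfc, hf, interp_comp_vertex, G.eLpNorm_indicator_massMeasure hp hA,
      one_div_toReal_conjExponent hν, ← neg_sub, ENNReal.rpow_neg]
  refine iInf_le_of_le f (iInf_le_of_le (G.isC1_interp _) (iInf₂_le_of_le hsplit ?_ ?_))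
  · rw [hN]
    exact ENNReal.inv_ne_zero.2 (ENNReal.rpow_ne_top_of_ne_zero hx (measure_ne_top _ _))
  · rw [hN, hf, gradNorm_interp, div_eq_mul_inv, inv_inv]

theorem isoConst_eq_splitSobolevConst {ν : ℝ≥0∞} (hν : 1 ≤ ν) :
    G.isoConst ν = G.splitSobolevConst ν := by
  refine le_antisymm (le_iInf₂ fun f hf => le_iInf₂ fun hs hne => ?_) ?_
  · have ht : G.norm ν.conjExponent f ≠ ⊤ := by
      rw [G.norm_eq _ hf.1]
      exact (G.eLpNorm_massMeasure_lt_top _ _).ne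
    rw [ENNReal.le_div_iff_mul_le (Or.inl hne) (Or.inl ht)]
    exact G.isoConst_mul_norm_le hν hf hs
  · rw [isoConst_eq]
    refine le_iInf fun A => le_iInf₂ fun hA hA' => ?_
    rcases le_total (G.massMeasure A) (G.massMeasure Aᶜ) with h | h
    · rw [min_eq_left h]
      exact G.splitSobolevConst_le_of_massMeasure_le hν hA h
    -- If the complement is lighter, its indicator is the split test function, with the same
    -- variation.
    · rw [min_eq_right h, ← variation_indicator_compl]
      exact G.splitSobolevConst_le_of_massMeasure_le hν hA' (by rwa [compl_compl])

/-! ### Comparison of the two constants and conclusion. -/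

theorem isoConst_le_isoConst' {ν : ℝ≥0∞} (hν : 1 ≤ ν) : G.isoConst ν ≤ G.isoConst' ν := by
  rw [isoConst_eq, isoConst'_eq]
  gcongr
  exact min_rpow_le_isoFactor hν

theorem isoConst'_le {ν : ℝ≥0∞} (hν : 1 ≤ ν) :
    G.isoConst' ν ≤ 2 ^ (ν⁻¹).toReal * G.isoConst ν := by
  have h0 : (2 : ℝ≥0∞) ^ (ν⁻¹).toReal ≠ 0 := by simp [ENNReal.rpow_eq_zero_iff]
  have ht : (2 : ℝ≥0∞) ^ (ν⁻¹).toReal ≠ ⊤ :=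
    ENNReal.rpow_ne_top_of_nonneg ENNReal.toReal_nonneg (by simp)
  rw [isoConst_eq, isoConst'_eq]
  simp only [ENNReal.mul_iInf_of_ne h0 ht]
  refine iInf_mono fun A => iInf₂_mono fun _ _ => ?_
  rw [mul_left_comm]
  gcongr
  exact isoFactor_le hν

end Constants

end ClosedGraph

end

theorem mainTheorem2 {V E : Type*} [Fintype V] [Fintype E] (G : ClosedGraph V E)
    (ν : ℝ≥0∞) (hν : 1 ≤ ν) :
    G.isoConst' ν = G.sobolevConst ν ∧
    G.isoConst ν = G.splitSobolevConst ν ∧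
    (G.isoConst ν ≤ G.isoConst' ν ∧ G.isoConst' ν ≤ 2 ^ (ν⁻¹).toReal * G.isoConst ν) ∧
    ∀ f : G.Realization → ℝ, G.IsC1 f → G.IsSplit f →
      G.isoConst ν * G.norm ν.conjExponent f ≤ G.gradNorm f := by
  -- The discrete σ-algebra on `V` is auxiliary: the statement involves only measures on the
  -- realization and its edge interiors.
  let _ : MeasurableSpace V := ⊤
  exact ⟨G.isoConst'_eq_sobolevConst hν, G.isoConst_eq_splitSobolevConst hν,
    ⟨G.isoConst_le_isoConst' hν, G.isoConst'_le hν⟩, fun _ hf hs => G.isoConst_mul_norm_le hν hf hs⟩
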